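/- Let $\Omega$ be an alphabet of $b\ge 2$ symbols, let $x=x_1x_2x_3\cdots\in\Omega^{\mathbb N}$ be an infinite sequence, and let $\lambda>0$ be a real number. For words $v,w$ over $\Omega$ let $|v|_w=\#\{1\le j\le |v|-|w|+1 : v[j\ldots j+|w|-1]=w\}$ be the number of (possibly overlapping) occurrences of $w$ in $v$, and let $x[1\ldots n]$ be the initial segment of $x$ of length $n$. For integers $i\ge 0$ and $k\ge 1$ let \[ Z^\lambda_{i,k}(x)=\frac{\#\{w\in\Omega^k : |x[1\ldots\lfloor\lambda b^k\rfloor+k-1]|_w=i\}}{b^k} \] be the proportion of words of length $k$ that occur exactly $i$ times in $x[1\ldots\lfloor\lambda b^k\rfloor+k-1]$, and put $p_i=\liminf_{k\to\infty}Z^\lambda_{i,k}(x)$. If $\sum_{i\ge 0} i\,p_i=\lambda$, then $x$ is Borel normal to base $b$, that is, for every word $w$ over $\Omega$, \[ \lim_{n\to\infty}\frac{|x[1\ldots n]|_w}{n}=b^{-|w|}. \] -/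

import Mathlib

open Filter Topology

namespace BorelNormality

/-- The number of occurrences of the word `w` in the word `v`: the number of (0-based) positions
`i` with `i + |w| ≤ |v|` such that the factor of `v` of length `|w|` starting at `i` is `w`. -/
def occ {Ω : Type*} [DecidableEq Ω] (v w : List Ω) : ℕ :=
  ((Finset.range (v.length + 1 - w.length)).filter
    (fun i => (v.drop i).take w.length = w)).card

/-- The initial segment of length `n` of the infinite sequence `x` (the first symbol of the
sequence is `x 0`). -/
def initSeg {Ω : Type*} (x : ℕ → Ω) (n : ℕ) : List Ω :=
  List.ofFn (fun j : Fin n => x j)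

/-- The proportion, among all words of length `k` over the `b`-symbol alphabet `Ω`, of those that
occur exactly `i` times in the initial segment of `x` of length `⌊lam * b ^ k⌋ + k - 1`. It is
meant for `k ≥ 1`. -/
noncomputable def Z {Ω : Type*} [Fintype Ω] [DecidableEq Ω]
    (lam : ℝ) (i k : ℕ) (x : ℕ → Ω) : ℝ :=
  ((Finset.univ.filter (fun w : Fin k → Ω =>
      occ (initSeg x (⌊lam * (Fintype.card Ω : ℝ) ^ k⌋₊ + k - 1)) (List.ofFn w) = i)).card : ℝ)
    / (Fintype.card Ω : ℝ) ^ k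

/-- Borel normality of a sequence over a `b`-symbol alphabet: every word `w` occurs in it with
limiting frequency `b ^ (-|w|)`. -/
def IsBorelNormal {Ω : Type*} [Fintype Ω] [DecidableEq Ω] (x : ℕ → Ω) : Prop :=
  ∀ w : List Ω, Tendsto (fun n : ℕ => (occ (initSeg x n) w : ℝ) / (n : ℝ)) atTop
    (𝓝 ((Fintype.card Ω : ℝ) ^ (-(w.length : ℤ))))

end BorelNormality

/-!
The mean over all words `w` of length `k` of the number of visits of `w` among the first
`N = ⌊lam * b ^ k⌋` positions of `x` is `N / b ^ k ≤ lam`. Since the limits inferior `p i` already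
carry the mean `lam`, a finite sum `∑ i < I, i * Z i` eventually nearly exhausts it. So words that
are visited at least `I` times account for at most `ε * b ^ k` positions, with `I` depending only
on `ε` (`exists_sum_frequent_le`).

Fix a word `v` of length `m`, and let the discrepancy of a word `u` of length `k = L + m` be the
number of occurrences of `v` at its first `L` positions, minus `L / b ^ m`. Its second moment over
all `u` is `O(L)` (`sum_discrepancy_sq_le`), so by Cauchy-Schwarz its absolute value is `O(√L)` on
average over all `u`. Read along `x`, a word counts with its number of visits, which is either less
than `I`, or belongs to the exceptional words, on which the discrepancy is at most `L`. Hence the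
discrepancies of the windows of `x` add up to at most `(I * O(√L) + ε * L) * b ^ k`
(`sum_visits_mul_le`). Averaging over windows turns this into a bound `o(b ^ k)` for the deviation
of the number of occurrences of `v` among the first `n` positions from `n / b ^ m`
(`eventually_abs_sum_centred_le_pow`). As all summands are absolute values, the bound holds for all
`n ≤ lam * b ^ k` at once; choosing the least such `k` for a given `n` makes `b ^ k = O(n)`, which
gives normality.
-/

namespace BorelNormality

/-- The word of length `k` read in the sequence `x` from position `j` on. -/
def window {Ω : Type*} (x : ℕ → Ω) (k j : ℕ) : Fin k → Ω := fun i => x (j + i)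

/-- The number of positions `j < N` at which the word `w` is read in the sequence `x`. -/
def visits {Ω : Type*} [DecidableEq Ω] (x : ℕ → Ω) {k : ℕ} (N : ℕ) (w : Fin k → Ω) : ℕ :=
  ((Finset.range N).filter (fun j => window x k j = w)).card

/-- The indicator of the word `v`, centred so that it has mean zero for the uniform distribution
on words of the same length. -/
noncomputable def centred {Ω : Type*} [Fintype Ω] [DecidableEq Ω] {m : ℕ} (v a : Fin m → Ω) : ℝ :=
  (if a = v then 1 else 0) - ((Fintype.card Ω : ℝ) ^ m)⁻¹

/-- The factor of length `m` at position `i < L` of a word of length `L + m`. -/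
def factor {Ω : Type*} {L m : ℕ} (u : Fin (L + m) → Ω) (i : Fin L) : Fin m → Ω :=
  fun t => u ⟨i + t, by omega⟩

/-- The discrepancy of a word `u` of length `L + m` with respect to a word `v` of length `m`: the
number of occurrences of `v` at the first `L` positions of `u`, minus its mean over all `u`. -/
noncomputable def discrepancy {Ω : Type*} [Fintype Ω] [DecidableEq Ω] {L m : ℕ} (v : Fin m → Ω)
    (u : Fin (L + m) → Ω) : ℝ :=
  ∑ i : Fin L, centred v (factor u i)

/-! ### Occurrences and windows -/

lemma occ_initSeg {Ω : Type*} [DecidableEq Ω] (x : ℕ → Ω) (n m : ℕ) (w : Fin m → Ω) :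
    occ (initSeg x n) (List.ofFn w) = visits x (n + 1 - m) w := by
  unfold occ visits
  have hl : (initSeg x n).length = n := by simp [initSeg]
  rw [hl, List.length_ofFn]
  congr 1
  apply Finset.filter_congr
  intro j hj
  have hj' : j + m ≤ n := by
    have := Finset.mem_range.1 hj
    omega
  have h : ((initSeg x n).drop j).take m = List.ofFn (window x m j) := by
    apply List.ext_getElem
    · simp [hl]; omega
    · intro i h1 h2
      simp [initSeg, window]
  rw [h, List.ofFn_inj]

lemma Z_eq {Ω : Type*} [Fintype Ω] [DecidableEq Ω] (lam : ℝ) (i k : ℕ) (hk : 1 ≤ k)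
    (x : ℕ → Ω) :
    Z lam i k x = ((Finset.univ.filter (fun w : Fin k → Ω =>
      visits x ⌊lam * (Fintype.card Ω : ℝ) ^ k⌋₊ w = i)).card : ℝ) / (Fintype.card Ω : ℝ) ^ k := by
  unfold Z
  have h : ∀ N : ℕ, N + k - 1 + 1 - k = N := by intro N; omega
  simp only [occ_initSeg, h]

lemma Z_nonneg {Ω : Type*} [Fintype Ω] [DecidableEq Ω] (lam : ℝ) (i k : ℕ) (x : ℕ → Ω) :
    0 ≤ Z lam i k x := by
  unfold Z
  positivity

/-- Summing along the sequence weights each word by its number of visits. -/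
lemma sum_window {Ω : Type*} [Fintype Ω] [DecidableEq Ω] (x : ℕ → Ω) {k : ℕ} (N : ℕ)
    (g : (Fin k → Ω) → ℝ) :
    ∑ j ∈ Finset.range N, g (window x k j) = ∑ w, (visits x N w : ℝ) * g w := by
  rw [← Finset.sum_fiberwise (Finset.range N) (fun j => window x k j)]
  refine Finset.sum_congr rfl fun w _ => ?_
  rw [Finset.sum_congr rfl (g := fun _ => g w)]
  · simp [visits]
  · intro j hj
    rw [(Finset.mem_filter.1 hj).2]

lemma factor_window {Ω : Type*} (x : ℕ → Ω) (L m j : ℕ) (i : Fin L) :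
    factor (window x (L + m) j) i = window x m (j + i) := by
  funext t
  simp [factor, window, add_assoc]

/-! ### The second moment of the discrepancy -/

lemma abs_centred_le {Ω : Type*} [Fintype Ω] [DecidableEq Ω] {m : ℕ} (v a : Fin m → Ω) :
    |centred v a| ≤ 1 := by
  have h0 : (0 : ℝ) ≤ ((Fintype.card Ω : ℝ) ^ m)⁻¹ := by positivity
  have h1 : ((Fintype.card Ω : ℝ) ^ m)⁻¹ ≤ 1 := by
    rw [← Nat.cast_pow]
    exact Nat.cast_inv_le_one _
  unfold centred
  split_ifs <;> rw [abs_le] <;> constructor <;> linarith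

lemma abs_discrepancy_le {Ω : Type*} [Fintype Ω] [DecidableEq Ω] {L m : ℕ} (v : Fin m → Ω)
    (u : Fin (L + m) → Ω) : |discrepancy v u| ≤ L := by
  unfold discrepancy
  refine (Finset.abs_sum_le_sum_abs _ _).trans ?_
  refine (Finset.sum_le_sum fun i _ => abs_centred_le v _).trans ?_
  simp

/-- Prescribing the values of a function on the image of an injection from `α` divides the number
of functions by `|Ω| ^ |α|`. -/
lemma sum_indicator_comp {Ω α κ : Type*} [Fintype Ω] [DecidableEq Ω] [Nonempty Ω] [Fintype α]
    [Fintype κ] [DecidableEq κ] (e : α → κ) (he : Function.Injective e) (g : α → Ω) :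
    ∑ u : κ → Ω, (if u ∘ e = g then (1 : ℝ) else 0) =
      (Fintype.card Ω : ℝ) ^ Fintype.card κ * ((Fintype.card Ω : ℝ) ^ Fintype.card α)⁻¹ := by
  classical
  have hq : (Fintype.card Ω : ℝ) ≠ 0 := by
    exact_mod_cast Fintype.card_ne_zero
  rw [Finset.sum_boole]
  have hset : (Finset.univ.filter fun u : κ → Ω => u ∘ e = g) =
      Fintype.piFinset (fun y : κ => Finset.univ.filter (fun o : Ω => ∀ a, e a = y → o = g a)) := by
    ext u
    simp only [Finset.mem_filter, Finset.mem_univ, true_and, Fintype.mem_piFinset]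
    constructor
    · rintro rfl y a rfl
      rfl
    · intro h
      funext a
      exact h (e a) a rfl
  have hcard : ∀ y : κ, (Finset.univ.filter (fun o : Ω => ∀ a, e a = y → o = g a)).card =
      if y ∈ Finset.univ.image e then 1 else Fintype.card Ω := by
    intro y
    split_ifs with hy
    · obtain ⟨a, -, rfl⟩ := Finset.mem_image.1 hy
      rw [Finset.card_eq_one]
      refine ⟨g a, ?_⟩
      ext o
      simp only [Finset.mem_filter, Finset.mem_univ, true_and, Finset.mem_singleton]
      constructor
      · intro h; exact h a rfl
      · rintro rfl a' h
        rw [he h]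
    · rw [Finset.filter_true_of_mem]
      · rfl
      · intro o _ a ha
        exact absurd (Finset.mem_image.2 ⟨a, Finset.mem_univ _, ha⟩) hy
  rw [hset, Fintype.card_piFinset]
  simp only [hcard]
  rw [Finset.prod_ite]
  have h2 : (Finset.univ.filter fun y : κ => y ∉ Finset.univ.image e).card + Fintype.card α =
      Fintype.card κ := by
    rw [← Finset.card_univ (α := α), ← Finset.card_image_of_injective _ he,
      ← Finset.card_compl_add_card (Finset.univ.image e)]
    congr 2
    ext y
    simp
  rw [Finset.prod_const_one, one_mul, Finset.prod_const, ← h2, pow_add]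
  push_cast
  field_simp

/-- Occurrences of `v` at two disjoint places of a random word are uncorrelated. -/
lemma sum_centred_mul_centred {Ω : Type*} [Fintype Ω] [DecidableEq Ω] [Nonempty Ω] {L m : ℕ}
    (v : Fin m → Ω) (i i' : Fin L) (h : (i : ℕ) + m ≤ i') :
    ∑ u : Fin (L + m) → Ω, centred v (factor u i) * centred v (factor u i') = 0 := by
  have hq : (Fintype.card Ω : ℝ) ≠ 0 := by
    exact_mod_cast Fintype.card_ne_zero
  have single : ∀ i : Fin L, ∑ u : Fin (L + m) → Ω, (if factor u i = v then (1 : ℝ) else 0) =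
      (Fintype.card Ω : ℝ) ^ (L + m) * ((Fintype.card Ω : ℝ) ^ m)⁻¹ := by
    intro i
    have := sum_indicator_comp (fun t : Fin m => (⟨i + t, by omega⟩ : Fin (L + m)))
      (by intro a b hab; simp at hab; omega) v
    simp only [Fintype.card_fin] at this
    exact this
  have pair : ∑ u : Fin (L + m) → Ω,
      (if factor u i = v then (1 : ℝ) else 0) * (if factor u i' = v then (1 : ℝ) else 0) =
      (Fintype.card Ω : ℝ) ^ (L + m) * ((Fintype.card Ω : ℝ) ^ (m + m))⁻¹ := by
    have := sum_indicator_comp (Sum.elim (fun t : Fin m => (⟨i + t, by omega⟩ : Fin (L + m)))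
      (fun t : Fin m => (⟨i' + t, by omega⟩ : Fin (L + m))))
      (by
        rintro (a | a) (b | b) hab <;> simp at hab <;> congr 1 <;> omega)
      (Sum.elim v v)
    simp only [Fintype.card_fin, Fintype.card_sum] at this
    rw [← this]
    refine Finset.sum_congr rfl fun u _ => ?_
    rw [ite_zero_mul_ite_zero, mul_one]
    congr 1
    simp only [eq_iff_iff]
    rw [← Sum.elim_comp_inl_inr (u ∘ _), Sum.elim_eq_iff]
    rfl
  simp only [centred, sub_mul, mul_sub, Finset.sum_sub_distrib, ← Finset.sum_mul,
    ← Finset.mul_sum, pair, single]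
  simp only [Finset.sum_const, Finset.card_univ, Fintype.card_fun, Fintype.card_fin, nsmul_eq_mul]
  push_cast
  field_simp
  ring

lemma card_close_le {L : ℕ} (m : ℕ) (i : Fin L) :
    (Finset.univ.filter fun i' : Fin L => (i' : ℕ) < i + m ∧ (i : ℕ) < i' + m).card ≤ 2 * m := by
  rw [← Finset.card_map Fin.valEmbedding]
  refine (Finset.card_le_card (t := Finset.Ico (i + 1 - m : ℕ) (i + m)) ?_).trans ?_
  · intro y hy
    simp only [Finset.mem_map, Finset.mem_filter, Finset.mem_univ, true_and,
      Fin.valEmbedding_apply] at hy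
    obtain ⟨a, ha, rfl⟩ := hy
    rw [Finset.mem_Ico]
    omega
  · rw [Nat.card_Ico]
    omega

/-- The variance of the discrepancy grows at most linearly in the length: in the expanded square,
only pairs of overlapping places contribute. -/
lemma sum_discrepancy_sq_le {Ω : Type*} [Fintype Ω] [DecidableEq Ω] [Nonempty Ω] {m : ℕ} (L : ℕ)
    (v : Fin m → Ω) :
    ∑ u : Fin (L + m) → Ω, discrepancy v u ^ 2 ≤
      2 * m * L * (Fintype.card Ω : ℝ) ^ (L + m) := by
  have key : ∀ i i' : Fin L,
      ∑ u : Fin (L + m) → Ω, centred v (factor u i) * centred v (factor u i') ≤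
      if (i' : ℕ) < i + m ∧ (i : ℕ) < i' + m then (Fintype.card Ω : ℝ) ^ (L + m) else 0 := by
    intro i i'
    split_ifs with h
    · refine (Finset.sum_le_sum (g := fun _ => (1 : ℝ)) fun u _ => ?_).trans ?_
      · refine (le_abs_self _).trans ?_
        rw [abs_mul]
        exact mul_le_one₀ (abs_centred_le _ _) (abs_nonneg _) (abs_centred_le _ _)
      · simp
    · rcases Nat.lt_or_ge i' (i + m) with h1 | h1
      · have h2 : (i' : ℕ) + m ≤ i := by
          by_contra h3
          exact h ⟨h1, by omega⟩
        simp_rw [mul_comm (centred v (factor _ i))]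
        exact (sum_centred_mul_centred v i' i h2).le
      · exact (sum_centred_mul_centred v i i' h1).le
  simp only [discrepancy, sq, Finset.sum_mul_sum]
  rw [Finset.sum_comm]
  have hrow : ∀ i : Fin L, ∑ u : Fin (L + m) → Ω, ∑ i' : Fin L,
      centred v (factor u i) * centred v (factor u i') ≤
      2 * m * (Fintype.card Ω : ℝ) ^ (L + m) := by
    intro i
    rw [Finset.sum_comm]
    refine (Finset.sum_le_sum fun i' _ => key i i').trans ?_
    rw [← Finset.sum_filter, Finset.sum_const, nsmul_eq_mul]
    gcongr
    exact_mod_cast card_close_le m i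
  refine (Finset.sum_le_sum fun i _ => hrow i).trans ?_
  rw [Finset.sum_const, Finset.card_univ, Fintype.card_fin, nsmul_eq_mul]
  apply le_of_eq
  ring

lemma sum_abs_discrepancy_le {Ω : Type*} [Fintype Ω] [DecidableEq Ω] [Nonempty Ω] {m : ℕ} (L : ℕ)
    (v : Fin m → Ω) :
    ∑ u : Fin (L + m) → Ω, |discrepancy v u| ≤
      √(2 * m * L) * (Fintype.card Ω : ℝ) ^ (L + m) := by
  have h := Finset.sum_mul_sq_le_sq_mul_sq (Finset.univ : Finset (Fin (L + m) → Ω))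
    (fun u => |discrepancy v u|) (fun _ => 1)
  simp only [mul_one, sq_abs, one_pow, Finset.sum_const, Finset.card_univ, Fintype.card_fun,
    Fintype.card_fin, nsmul_eq_mul] at h
  push_cast at h
  have h2 := sum_discrepancy_sq_le L v
  refine abs_le_of_sq_le_sq' ?_ (by positivity) |>.2
  rw [mul_pow, Real.sq_sqrt (by positivity)]
  refine h.trans ?_
  rw [sq ((Fintype.card Ω : ℝ) ^ (L + m)), ← mul_assoc]
  gcongr

/-! ### Words that occur too often -/

/-- If words visited at least `I` times account for few positions, then the discrepancy is small
on average along the sequence. -/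
lemma sum_visits_mul_le {Ω : Type*} [Fintype Ω] [DecidableEq Ω] [Nonempty Ω] {m L : ℕ}
    (v : Fin m → Ω) (x : ℕ → Ω) (N I : ℕ) (δ : ℝ)
    (htail : ∑ w : Fin (L + m) → Ω, (if visits x N w < I then 0 else (visits x N w : ℝ)) ≤ δ) :
    ∑ j ∈ Finset.range N, |discrepancy v (window x (L + m) j)| ≤
      I * (√(2 * m * L) * (Fintype.card Ω : ℝ) ^ (L + m)) + L * δ := by
  rw [sum_window x N (fun w => |discrepancy v w|)]
  have h : ∀ w : Fin (L + m) → Ω, (visits x N w : ℝ) * |discrepancy v w| ≤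
      I * |discrepancy v w| + L * (if visits x N w < I then 0 else (visits x N w : ℝ)) := by
    intro w
    have h0 := abs_nonneg (discrepancy v w)
    split_ifs with hw
    · have : (visits x N w : ℝ) ≤ I := by exact_mod_cast hw.le
      rw [mul_zero, add_zero]
      gcongr
    · have h1 := abs_discrepancy_le v w
      have h2 : (visits x N w : ℝ) * |discrepancy v w| ≤ visits x N w * L := by gcongr
      have h3 : (0 : ℝ) ≤ I * |discrepancy v w| := by positivity
      linarith
  refine (Finset.sum_le_sum fun w _ => h w).trans ?_
  rw [Finset.sum_add_distrib, ← Finset.mul_sum, ← Finset.mul_sum]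
  gcongr
  exact sum_abs_discrepancy_le L v

lemma sum_visits {Ω : Type*} [Fintype Ω] [DecidableEq Ω] (x : ℕ → Ω) (k N : ℕ) :
    ∑ w : Fin k → Ω, (visits x N w : ℝ) = N := by
  have := sum_window (k := k) x N (fun _ => 1)
  simp only [mul_one] at this
  rw [← this]
  simp

/-- The words visited at least `I` times account for the positions that the first `I` terms of the
mean `∑ i * Z i` miss. -/
lemma sum_frequent_eq {Ω : Type*} [Fintype Ω] [DecidableEq Ω] [Nonempty Ω] (lam : ℝ) (x : ℕ → Ω)
    (k I : ℕ) (hk : 1 ≤ k) :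
    ∑ w : Fin k → Ω, (if visits x ⌊lam * (Fintype.card Ω : ℝ) ^ k⌋₊ w < I then 0
        else (visits x ⌊lam * (Fintype.card Ω : ℝ) ^ k⌋₊ w : ℝ)) =
      ⌊lam * (Fintype.card Ω : ℝ) ^ k⌋₊ -
        (∑ i ∈ Finset.range I, (i : ℝ) * Z lam i k x) * (Fintype.card Ω : ℝ) ^ k := by
  have hq : (Fintype.card Ω : ℝ) ≠ 0 := by
    exact_mod_cast Fintype.card_ne_zero
  simp only [Z_eq lam _ k hk]
  rw [Finset.sum_mul]
  generalize ⌊lam * (Fintype.card Ω : ℝ) ^ k⌋₊ = N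
  rw [eq_sub_iff_add_eq, ← sum_visits x k N]
  have h : ∀ i ∈ Finset.range I, (i : ℝ) * (((Finset.univ.filter (fun w : Fin k → Ω =>
      visits x N w = i)).card : ℝ) / (Fintype.card Ω : ℝ) ^ k) * (Fintype.card Ω : ℝ) ^ k =
      ∑ w : Fin k → Ω, if visits x N w = i then (i : ℝ) else 0 := by
    intro i _
    rw [← Finset.sum_filter, Finset.sum_const, nsmul_eq_mul]
    field_simp
  rw [Finset.sum_congr rfl h, Finset.sum_comm, ← Finset.sum_add_distrib]
  refine Finset.sum_congr rfl fun w _ => ?_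
  rw [Finset.sum_ite_eq]
  simp only [Finset.mem_range]
  split_ifs <;> simp

/-- Tightness: since the limits inferior `p i` already carry the whole mean `lam`, no mass of the
mean number of visits escapes to infinity. -/
lemma exists_sum_frequent_le {Ω : Type*} [Fintype Ω] [DecidableEq Ω] [Nonempty Ω]
    (x : ℕ → Ω) (lam : ℝ) (hlam : 0 < lam) (p : ℕ → ℝ)
    (hp : ∀ i : ℕ, p i = liminf (fun k : ℕ => Z lam i k x) atTop)
    (hsum : HasSum (fun i : ℕ => (i : ℝ) * p i) lam) (ε : ℝ) (hε : 0 < ε) :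
    ∃ I : ℕ, ∀ᶠ k : ℕ in atTop,
      ∑ w : Fin k → Ω, (if visits x ⌊lam * (Fintype.card Ω : ℝ) ^ k⌋₊ w < I then 0
        else (visits x ⌊lam * (Fintype.card Ω : ℝ) ^ k⌋₊ w : ℝ)) ≤
      ε * (Fintype.card Ω : ℝ) ^ k := by
  obtain ⟨I, hI⟩ := (hsum.tendsto_sum_nat.eventually
    (lt_mem_nhds (show lam - ε / 2 < lam by linarith))).exists
  refine ⟨I, ?_⟩
  set S : ℝ := ∑ i ∈ Finset.range I, (i : ℝ) with hS
  have hS0 : 0 ≤ S := by positivity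
  have hZ : ∀ᶠ k : ℕ in atTop, ∀ i ∈ Finset.range I,
      p i - ε / 2 / (S + 1) < Z lam i k x := by
    rw [Filter.eventually_all_finset]
    intro i _
    apply eventually_lt_of_lt_liminf
    · rw [← hp i]
      have : 0 < ε / 2 / (S + 1) := by positivity
      linarith
    · exact isBoundedUnder_of ⟨0, fun k => Z_nonneg lam i k x⟩
  filter_upwards [hZ, eventually_ge_atTop 1] with k hk hk1
  rw [sum_frequent_eq lam x k I hk1]
  have h1 : ∑ i ∈ Finset.range I, (i : ℝ) * p i - S * (ε / 2 / (S + 1)) ≤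
      ∑ i ∈ Finset.range I, (i : ℝ) * Z lam i k x := by
    rw [hS, Finset.sum_mul, ← Finset.sum_sub_distrib, ← hS]
    refine Finset.sum_le_sum fun i hi => ?_
    rw [← mul_sub]
    exact mul_le_mul_of_nonneg_left (hk i hi).le (Nat.cast_nonneg i)
  have h2 : S * (ε / 2 / (S + 1)) ≤ ε / 2 := by
    rw [mul_div_assoc', div_le_iff₀ (by positivity)]
    nlinarith
  have h3 : (⌊lam * (Fintype.card Ω : ℝ) ^ k⌋₊ : ℝ) ≤ lam * (Fintype.card Ω : ℝ) ^ k :=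
    Nat.floor_le (by positivity)
  have h4 : (lam - ε) * (Fintype.card Ω : ℝ) ^ k ≤
      (∑ i ∈ Finset.range I, (i : ℝ) * Z lam i k x) * (Fintype.card Ω : ℝ) ^ k := by
    gcongr
    linarith
  linarith

/-! ### Averaging over windows -/

lemma abs_sum_shift_sub_le (a : ℕ → ℝ) (ha : ∀ j, |a j| ≤ 1) (n i : ℕ) :
    |∑ j ∈ Finset.range n, a j - ∑ j ∈ Finset.range n, a (j + i)| ≤ 2 * i := by
  have hb : ∀ f : ℕ → ℝ, (∀ j, |f j| ≤ 1) → |∑ j ∈ Finset.range i, f j| ≤ i := by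
    intro f hf
    refine (Finset.abs_sum_le_sum_abs _ _).trans ((Finset.sum_le_sum fun j _ => hf j).trans ?_)
    simp
  have h1 := Finset.sum_range_add a n i
  have h2 := Finset.sum_range_add a i n
  rw [add_comm i n, h1] at h2
  have h3 : ∑ j ∈ Finset.range n, a j - ∑ j ∈ Finset.range n, a (j + i) =
      ∑ j ∈ Finset.range i, a j - ∑ j ∈ Finset.range i, a (n + j) := by
    simp only [add_comm _ i]
    linarith
  rw [h3]
  have h4 := hb a ha
  have h5 := hb (fun j => a (n + j)) (fun j => ha _)
  have h6 := abs_sub (∑ j ∈ Finset.range i, a j) (∑ j ∈ Finset.range i, a (n + j))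
  linarith

/-- Replacing the sum along the sequence by the average of the discrepancies over windows costs only
the boundary terms. -/
lemma mul_abs_sum_centred_le {Ω : Type*} [Fintype Ω] [DecidableEq Ω] {m : ℕ} (v : Fin m → Ω)
    (x : ℕ → Ω) (L n : ℕ) :
    L * |∑ j ∈ Finset.range n, centred v (window x m j)| ≤
      ∑ j ∈ Finset.range n, |discrepancy v (window x (L + m) j)| + L * (2 * L) := by
  have hdisc : ∑ j ∈ Finset.range n, discrepancy v (window x (L + m) j) =
      ∑ i : Fin L, ∑ j ∈ Finset.range n, centred v (window x m (j + i)) := by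
    simp only [discrepancy, factor_window]
    exact Finset.sum_comm
  have hdiff : |∑ i : Fin L, (∑ j ∈ Finset.range n, centred v (window x m j) -
      ∑ j ∈ Finset.range n, centred v (window x m (j + i)))| ≤ L * (2 * L) := by
    refine (Finset.abs_sum_le_sum_abs _ _).trans ?_
    refine (Finset.sum_le_sum (g := fun _ => (2 * L : ℝ)) fun i _ => ?_).trans ?_
    · refine (abs_sum_shift_sub_le (fun j => centred v (window x m j))
        (fun j => abs_centred_le _ _) n i).trans ?_
      have : ((i : ℕ) : ℝ) ≤ L := by exact_mod_cast i.2.le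
      linarith
    · simp
  rw [Finset.sum_sub_distrib, ← hdisc, Finset.sum_const, Finset.card_univ, Fintype.card_fin,
    nsmul_eq_mul] at hdiff
  have h1 := Finset.abs_sum_le_sum_abs
    (fun j => discrepancy v (window x (L + m) j)) (Finset.range n)
  have h2 := abs_sub_abs_le_abs_sub
    (L * ∑ j ∈ Finset.range n, centred v (window x m j))
    (∑ j ∈ Finset.range n, discrepancy v (window x (L + m) j))
  rw [abs_mul, Nat.abs_cast] at h2
  linarith

/-- Up to `lam * b ^ k`, every partial sum of centred occurrences of `v` is `o(b ^ k)`. -/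
lemma eventually_abs_sum_centred_le_pow {Ω : Type*} [Fintype Ω] [DecidableEq Ω]
    (hb : 2 ≤ Fintype.card Ω) (x : ℕ → Ω) (lam : ℝ) (hlam : 0 < lam) (p : ℕ → ℝ)
    (hp : ∀ i : ℕ, p i = liminf (fun k : ℕ => Z lam i k x) atTop)
    (hsum : HasSum (fun i : ℕ => (i : ℝ) * p i) lam) {m : ℕ} (v : Fin m → Ω)
    (ε : ℝ) (hε : 0 < ε) :
    ∀ᶠ k : ℕ in atTop, ∀ n ≤ ⌊lam * (Fintype.card Ω : ℝ) ^ k⌋₊,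
      |∑ j ∈ Finset.range n, centred v (window x m j)| ≤ ε * (Fintype.card Ω : ℝ) ^ k := by
  have : Nonempty Ω := Fintype.card_pos_iff.1 (by omega)
  obtain ⟨I, hI⟩ := exists_sum_frequent_le x lam hlam p hp hsum (ε / 3) (by positivity)
  have hq1 : (1 : ℝ) < Fintype.card Ω := by exact_mod_cast hb
  have hlin : ∀ᶠ k : ℕ in atTop, 2 * (k : ℝ) ≤ ε / 3 * (Fintype.card Ω : ℝ) ^ k := by
    have h := tendsto_pow_const_div_const_pow_of_one_lt 1 hq1
    filter_upwards [h.eventually (gt_mem_nhds (show (0 : ℝ) < ε / 6 by positivity))] with k hk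
    rw [pow_one, div_lt_iff₀ (by positivity)] at hk
    linarith
  have hsqrt : ∀ᶠ L : ℕ in atTop, I * √(2 * m * L) ≤ ε / 3 * L := by
    have h : Tendsto (fun L : ℕ => √(L : ℝ)) atTop atTop :=
      Real.tendsto_sqrt_atTop.comp tendsto_natCast_atTop_atTop
    filter_upwards [h.eventually_ge_atTop (I * √(2 * m) / (ε / 3))] with L hL
    rw [div_le_iff₀ (by positivity)] at hL
    rw [Real.sqrt_mul (by positivity), ← mul_assoc]
    calc I * √(2 * m) * √(L : ℝ) ≤ (√(L : ℝ) * (ε / 3)) * √(L : ℝ) := by gcongr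
      _ = ε / 3 * (√(L : ℝ) * √(L : ℝ)) := by ring
      _ = ε / 3 * L := by rw [Real.mul_self_sqrt (by positivity)]
  have hsub : Tendsto (fun k : ℕ => k - m) atTop atTop := tendsto_sub_atTop_nat m
  filter_upwards [hI, hlin, hsub.eventually hsqrt, eventually_ge_atTop (m + 1)]
    with k hk1 hk2 hk3 hk4 n hn
  obtain ⟨L, rfl⟩ : ∃ L, k = L + m := ⟨k - m, by omega⟩
  rw [Nat.add_sub_cancel] at hk3
  have hL : (0 : ℝ) < L := by
    have : 0 < L := by omega
    exact_mod_cast this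
  have h1 := mul_abs_sum_centred_le v x L n
  have h2 := sum_visits_mul_le v x _ I _ hk1
  have h3 : ∑ j ∈ Finset.range n, |discrepancy v (window x (L + m) j)| ≤
      ∑ j ∈ Finset.range ⌊lam * (Fintype.card Ω : ℝ) ^ (L + m)⌋₊,
        |discrepancy v (window x (L + m) j)| :=
    Finset.sum_le_sum_of_subset_of_nonneg (Finset.range_mono hn) fun _ _ _ => abs_nonneg _
  set Q : ℝ := (Fintype.card Ω : ℝ) ^ (L + m) with hQ
  have h4 : I * √(2 * m * L) * Q ≤ ε / 3 * L * Q := by gcongr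
  have h5 : (L : ℝ) * (2 * L) ≤ L * (ε / 3 * Q) := by
    push_cast at hk2
    have : (0 : ℝ) ≤ m := Nat.cast_nonneg m
    refine mul_le_mul_of_nonneg_left ?_ hL.le
    linarith
  refine le_of_mul_le_mul_left ?_ hL
  linarith

/-- Consecutive scales `lam * b ^ (k - 1)` and `lam * b ^ k` have bounded ratio, so the bound at
the scale `k` covers all lengths in between. -/
lemma eventually_abs_sum_centred_le {Ω : Type*} [Fintype Ω] [DecidableEq Ω]
    (hb : 2 ≤ Fintype.card Ω) (x : ℕ → Ω) (lam : ℝ) (hlam : 0 < lam) (p : ℕ → ℝ)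
    (hp : ∀ i : ℕ, p i = liminf (fun k : ℕ => Z lam i k x) atTop)
    (hsum : HasSum (fun i : ℕ => (i : ℝ) * p i) lam) {m : ℕ} (v : Fin m → Ω)
    (ε : ℝ) (hε : 0 < ε) :
    ∀ᶠ n : ℕ in atTop, |∑ j ∈ Finset.range n, centred v (window x m j)| ≤ ε * n := by
  have hq1 : (1 : ℝ) < Fintype.card Ω := by exact_mod_cast hb
  have hq0 : (0 : ℝ) < Fintype.card Ω := by linarith
  obtain ⟨K, hK⟩ := eventually_atTop.1 (eventually_abs_sum_centred_le_pow hb x lam hlam p hp hsum v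
    (ε * (lam / Fintype.card Ω)) (by positivity))
  have hmono : Monotone fun k : ℕ => ⌊lam * (Fintype.card Ω : ℝ) ^ k⌋₊ := by
    intro k l hkl
    dsimp only
    gcongr
    exact hq1.le
  have htop : Tendsto (fun k : ℕ => ⌊lam * (Fintype.card Ω : ℝ) ^ k⌋₊) atTop atTop :=
    tendsto_nat_floor_atTop.comp ((tendsto_pow_atTop_atTop_of_one_lt hq1).const_mul_atTop hlam)
  filter_upwards [eventually_gt_atTop ⌊lam * (Fintype.card Ω : ℝ) ^ K⌋₊] with n hn
  have hex : ∃ k : ℕ, n ≤ ⌊lam * (Fintype.card Ω : ℝ) ^ k⌋₊ := (htop.eventually_ge_atTop n).exists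
  classical
  obtain ⟨k, hk, hmin⟩ : ∃ k : ℕ, n ≤ ⌊lam * (Fintype.card Ω : ℝ) ^ k⌋₊ ∧
      ∀ l < k, ¬ n ≤ ⌊lam * (Fintype.card Ω : ℝ) ^ l⌋₊ :=
    ⟨Nat.find hex, Nat.find_spec hex, fun l hl => Nat.find_min hex hl⟩
  have hKk : K < k := by
    by_contra hle
    have := hmono (not_lt.1 hle)
    dsimp only at this
    omega
  obtain ⟨l, rfl⟩ : ∃ l, k = l + 1 := ⟨k - 1, by omega⟩
  have hl : lam * (Fintype.card Ω : ℝ) ^ l < n :=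
    (Nat.floor_lt (by positivity)).1 (not_le.1 (hmin l (by omega)))
  refine (hK (l + 1) hKk.le n hk).trans ?_
  calc ε * (lam / Fintype.card Ω) * (Fintype.card Ω : ℝ) ^ (l + 1)
      = ε * (lam * (Fintype.card Ω : ℝ) ^ l) := by
        rw [pow_succ]
        field_simp
    _ ≤ ε * n := by gcongr

/-! ### Normality -/

lemma visits_eq_sum_centred {Ω : Type*} [Fintype Ω] [DecidableEq Ω] {m : ℕ} (v : Fin m → Ω)
    (x : ℕ → Ω) (N : ℕ) :
    (visits x N v : ℝ) = ∑ j ∈ Finset.range N, centred v (window x m j) +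
      N * ((Fintype.card Ω : ℝ) ^ m)⁻¹ := by
  simp [centred, visits, Finset.sum_sub_distrib]

end BorelNormality

open BorelNormality in
theorem theorem2 {Ω : Type*} [Fintype Ω] [DecidableEq Ω] (hb : 2 ≤ Fintype.card Ω)
    (x : ℕ → Ω) (lam : ℝ) (hlam : 0 < lam) (p : ℕ → ℝ)
    (hp : ∀ i : ℕ, p i = liminf (fun k : ℕ => BorelNormality.Z lam i k x) atTop)
    (hsum : HasSum (fun i : ℕ => (i : ℝ) * p i) lam) :
    BorelNormality.IsBorelNormal x := by
  intro w
  obtain ⟨m, v, rfl⟩ : ∃ (m : ℕ) (v : Fin m → Ω), w = List.ofFn v :=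
    ⟨w.length, w.get, (List.ofFn_get w).symm⟩
  simp only [occ_initSeg, List.length_ofFn, zpow_neg, zpow_natCast]
  have hq0 : (0 : ℝ) < Fintype.card Ω := by
    have : 0 < Fintype.card Ω := by omega
    exact_mod_cast this
  -- The number `n + 1 - m` of admissible positions is asymptotically `n`.
  have hratio : Tendsto (fun n : ℕ => ((n + 1 - m : ℕ) : ℝ) / n) atTop (𝓝 1) := by
    have h := (tendsto_const_nhds (x := (1 : ℝ))).add
      (tendsto_const_div_atTop_nhds_zero_nat (1 - m : ℝ))
    rw [add_zero] at h
    refine h.congr' ?_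
    filter_upwards [eventually_ge_atTop (m + 1)] with n hn
    have hn0 : (n : ℝ) ≠ 0 := by
      have : n ≠ 0 := by omega
      exact_mod_cast this
    rw [Nat.cast_sub (by omega)]
    push_cast
    field_simp
    ring
  have hshift : Tendsto (fun n : ℕ => n + 1 - m) atTop atTop :=
    (tendsto_sub_atTop_nat m).comp (tendsto_add_atTop_nat 1)
  have hmean : Tendsto (fun N : ℕ => (visits x N v : ℝ) / N) atTop
      (𝓝 ((Fintype.card Ω : ℝ) ^ m)⁻¹) := by
    rw [Metric.tendsto_atTop']
    intro ε hε
    obtain ⟨N₀, hN₀⟩ := eventually_atTop.1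
      (eventually_abs_sum_centred_le hb x lam hlam p hp hsum v (ε / 2) (by positivity))
    refine ⟨N₀, fun N hN => ?_⟩
    have hNpos : (0 : ℝ) < N := by
      have : 0 < N := by omega
      exact_mod_cast this
    have h := hN₀ N hN.le
    rw [Real.dist_eq, visits_eq_sum_centred, add_div, mul_div_cancel_left₀ _ hNpos.ne',
      add_sub_cancel_right, abs_div, Nat.abs_cast, div_lt_iff₀ hNpos]
    nlinarith
  have h := (hmean.comp hshift).mul hratio
  rw [mul_one] at h
  refine h.congr' ?_
  filter_upwards [hshift.eventually_ge_atTop 1] with n hn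
  have hn0 : ((n + 1 - m : ℕ) : ℝ) ≠ 0 := by
    have : n + 1 - m ≠ 0 := by omega
    exact_mod_cast this
  simp only [Function.comp_apply]
  field_simp
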